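/- Let $R$ be an associative ring with identity, not necessarily commutative. A submodule $X$ of a module $N$ is essential in $N$ if every nonzero submodule of $N$ meets $X$ nontrivially, and a submodule $X$ of a module $M$ is closed if it is not essential in any submodule of $M$ properly containing it. A minimal closed submodule is a minimal element among the nonzero closed submodules of $M$, and a maximal closed submodule is a maximal element among the proper closed submodules of $M$. A module $M$ is min CS if every minimal closed submodule of $M$ is a direct summand; it is max CS if every maximal closed submodule of $M$ that is annihilated by some nonzero endomorphism of $M$ is a direct summand; it is max-min CS if it is both max CS and min CS. The ring $R$ is right (resp. left) min CS, max CS or max-min CS if the right module $R_R$ (resp. the left module ${}_RR$) is so. Assume that $R$ is nonsingular, that is, every essential right ideal $I$ of $R$ has zero left annihilator $\{x\in R : xI=0\}$ and every essential left ideal $I$ of $R$ has zero right annihilator $\{x\in R : Ix=0\}$. Assume also that $R$ is Utumi, that is, every right ideal of $R$ with zero left annihilator is essential in $R_R$ and every left ideal of $R$ with zero right annihilator is essential in ${}_RR$. Then: 1. $R$ is right min CS if and only if $R$ is left max CS. 2. $R$ is right max CS if and only if $R$ is left min CS. 3. $R$ is right max-min CS if and only if $R$ is left max-min CS. -/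

import Mathlib

namespace MaxMinCS

/-! ### Essential, closed, minimal closed and maximal closed submodules

A right `R`-module is a module over `Rᵐᵒᵖ`; in particular the right ideals of `R` are the terms of
`Submodule Rᵐᵒᵖ R`, and the left ideals are the terms of `Submodule R R`. -/

section Modules

variable {A M : Type*} [Ring A] [AddCommGroup M] [Module A M]

/-- `X` is an essential submodule of `Y`: `X ≤ Y` and the only submodule of `Y` meeting `X` in zero
is the zero submodule. -/
def IsEssentialIn (X Y : Submodule A M) : Prop :=
  X ≤ Y ∧ ∀ Z : Submodule A M, Z ≤ Y → X ⊓ Z = ⊥ → Z = ⊥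

/-- `X` is a closed submodule: it has no proper essential extension in the module. -/
def IsClosedSubmodule (X : Submodule A M) : Prop :=
  ∀ Y : Submodule A M, IsEssentialIn X Y → X = Y

/-- A minimal closed submodule: minimal among the nonzero closed submodules. -/
def IsMinimalClosed (X : Submodule A M) : Prop :=
  Minimal (fun Y : Submodule A M => IsClosedSubmodule Y ∧ Y ≠ ⊥) X

/-- A maximal closed submodule: maximal among the proper closed submodules. -/
def IsMaximalClosed (X : Submodule A M) : Prop :=
  Maximal (fun Y : Submodule A M => IsClosedSubmodule Y ∧ Y ≠ ⊤) X

/-- The annihilator of `X` in the endomorphism ring of the module is nonzero. -/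
def HasNonzeroEndAnnihilator (X : Submodule A M) : Prop :=
  ∃ f : Module.End A M, f ≠ 0 ∧ ∀ x ∈ X, f x = 0

variable (A M)

/-- Min CS modules: every minimal closed submodule is a direct summand. -/
def IsMinCSModule : Prop :=
  ∀ X : Submodule A M, IsMinimalClosed X → IsComplemented X

/-- Max CS modules: every maximal closed submodule with nonzero annihilator in the endomorphism
ring is a direct summand. -/
def IsMaxCSModule : Prop :=
  ∀ X : Submodule A M, IsMaximalClosed X → HasNonzeroEndAnnihilator X → IsComplemented X

/-- Max-min CS modules: both max CS and min CS. -/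
def IsMaxMinCSModule : Prop :=
  IsMaxCSModule A M ∧ IsMinCSModule A M

end Modules

section Rings

variable (R : Type*) [Ring R]

/-- Every essential right ideal has zero left annihilator. -/
def IsRightNonsingular : Prop :=
  ∀ I : Submodule Rᵐᵒᵖ R, IsEssentialIn I ⊤ → ∀ x : R, (∀ y ∈ I, x * y = 0) → x = 0

/-- Every essential left ideal has zero right annihilator. -/
def IsLeftNonsingular : Prop :=
  ∀ I : Submodule R R, IsEssentialIn I ⊤ → ∀ x : R, (∀ y ∈ I, y * x = 0) → x = 0

/-- A nonsingular ring is right and left nonsingular. -/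
def IsNonsingular : Prop :=
  IsRightNonsingular R ∧ IsLeftNonsingular R

/-- Every right ideal with zero left annihilator is essential. -/
def IsRightUtumi : Prop :=
  ∀ I : Submodule Rᵐᵒᵖ R, (∀ x : R, (∀ y ∈ I, x * y = 0) → x = 0) → IsEssentialIn I ⊤

/-- Every left ideal with zero right annihilator is essential. -/
def IsLeftUtumi : Prop :=
  ∀ I : Submodule R R, (∀ x : R, (∀ y ∈ I, y * x = 0) → x = 0) → IsEssentialIn I ⊤

/-- A Utumi ring is right and left Utumi. -/
def IsUtumi : Prop :=
  IsRightUtumi R ∧ IsLeftUtumi R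

/-- `R` is right min CS: the right module `R` is min CS. -/
def IsRightMinCS : Prop := IsMinCSModule Rᵐᵒᵖ R

/-- `R` is left min CS: the left module `R` is min CS. -/
def IsLeftMinCS : Prop := IsMinCSModule R R

/-- `R` is right max CS: the right module `R` is max CS. -/
def IsRightMaxCS : Prop := IsMaxCSModule Rᵐᵒᵖ R

/-- `R` is left max CS: the left module `R` is max CS. -/
def IsLeftMaxCS : Prop := IsMaxCSModule R R

/-- `R` is right max-min CS: the right module `R` is max-min CS. -/
def IsRightMaxMinCS : Prop := IsMaxMinCSModule Rᵐᵒᵖ R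

/-- `R` is left max-min CS: the left module `R` is max-min CS. -/
def IsLeftMaxMinCS : Prop := IsMaxMinCSModule R R

end Rings

end MaxMinCS

namespace MaxMinCS

section Pairing

set_option linter.unusedSectionVars false

variable {A B M : Type*} [Ring A] [Ring B] [AddCommGroup M] [Module A M] [Module B M]

/-! In a nonsingular Utumi ring, left and right annihilators are mutually inverse,
inclusion-reversing bijections between closed right ideals and closed left ideals
(`isClosedSubmodule_pairingAnnihilator`, `pairingAnnihilator_flip_pairingAnnihilator`). They
therefore exchange minimal closed with maximal closed ideals, and they preserve direct summands
(`IsRingPairing.isComplemented_pairingAnnihilator`). Multiplication is abstracted to a pairing `p`,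
so that each lemma serves the opposite side through `p.flip`. -/

theorem exists_disjoint_sup_isEssentialIn {I K : Submodule A M} (h : Disjoint I K) :
    ∃ J : Submodule A M, I ≤ J ∧ Disjoint J K ∧ IsEssentialIn (J ⊔ K) ⊤ := by
  obtain ⟨J, hIJ, hJ⟩ := zorn_le_nonempty₀ {J : Submodule A M | Disjoint J K}
    (fun c hc hchain y hy => ⟨sSup c, by
      change Disjoint (sSup c) K
      rw [Submodule.disjoint_def]
      intro x hx hxK
      obtain ⟨J, hJc, hxJ⟩ := (Submodule.mem_sSup_of_directed ⟨y, hy⟩ hchain.directedOn).1 hx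
      exact Submodule.disjoint_def.1 (hc hJc) x hxJ hxK, fun z hz => le_sSup hz⟩) I h
  refine ⟨J, hIJ, hJ.1, le_top, fun Z _ hZ => ?_⟩
  -- A `Z` independent of `J ⊔ K` can be absorbed into `J`, so maximality of `J` forces `Z ≤ J`.
  have hd : Disjoint (J ⊔ Z) K := by
    have h1 : Disjoint (K ⊔ J) Z := by rw [sup_comm]; exact disjoint_iff.2 hZ
    exact (Disjoint.disjoint_sup_right_of_disjoint_sup_left hJ.1.symm h1).symm
  have hle : Z ≤ J := le_sup_right.trans (hJ.2 hd le_sup_left)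
  rw [← hZ, eq_comm, inf_eq_right]
  exact hle.trans le_sup_left

variable [SMulCommClass A B M]

/-- The elements of `M` pairing to zero with every element of `X`. -/
def pairingAnnihilator (p : M →ₗ[B] M →ₗ[A] M) (X : Submodule A M) : Submodule B M where
  carrier := {x | ∀ y ∈ X, p x y = 0}
  add_mem' {a b} ha hb y hy := by simp [ha y hy, hb y hy]
  zero_mem' y _ := by simp
  smul_mem' c x hx y hy := by simp [hx y hy]

theorem pairingAnnihilator_anti (p : M →ₗ[B] M →ₗ[A] M) {X Y : Submodule A M} (h : X ≤ Y) :
    pairingAnnihilator p Y ≤ pairingAnnihilator p X :=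
  fun _ hx y hy => hx y (h hy)

theorem pairingAnnihilator_bot (p : M →ₗ[B] M →ₗ[A] M) : pairingAnnihilator p ⊥ = ⊤ := by
  refine eq_top_iff.2 fun x _ y hy => ?_
  rw [(Submodule.mem_bot A).1 hy, map_zero]

/-- The pairing `p` is the multiplication of a unital ring structure on `M` whose right ideals
are the `A`-submodules and whose left ideals are the `B`-submodules, up to exchanging sides. -/
structure IsRingPairing (p : M →ₗ[B] M →ₗ[A] M) (e : M) : Prop where
  assoc : ∀ x y z, p (p x y) z = p x (p y z)
  one_left : ∀ x, p e x = x
  one_right : ∀ x, p x e = x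
  right_smul : ∀ y t, ∃ a : A, p y t = a • y
  left_smul : ∀ t x, ∃ b : B, p t x = b • x

/-- Essential submodules have zero annihilator. -/
def IsNonsingularPairing (p : M →ₗ[B] M →ₗ[A] M) : Prop :=
  ∀ I : Submodule A M, IsEssentialIn I ⊤ → ∀ x : M, (∀ y ∈ I, p x y = 0) → x = 0

/-- Submodules with zero annihilator are essential. -/
def IsUtumiPairing (p : M →ₗ[B] M →ₗ[A] M) : Prop :=
  ∀ I : Submodule A M, (∀ x : M, (∀ y ∈ I, p x y = 0) → x = 0) → IsEssentialIn I ⊤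

variable {p : M →ₗ[B] M →ₗ[A] M} {e : M}

theorem IsRingPairing.pairingAnnihilator_top (h : IsRingPairing p e) :
    pairingAnnihilator p ⊤ = ⊥ := by
  refine eq_bot_iff.2 fun x hx => ?_
  rw [Submodule.mem_bot, ← h.one_right x]
  exact hx e trivial

/-- Split the identity as `e = u + v` along `X ⊕ Y`. Then `v` kills `X` and `u` kills `Y`, so `a =
av + au` decomposes every `a` along the two annihilators. -/
theorem IsRingPairing.isComplemented_pairingAnnihilator (h : IsRingPairing p e)
    {X : Submodule A M} (hX : IsComplemented X) : IsComplemented (pairingAnnihilator p X) := by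
  obtain ⟨Y, hXY⟩ := hX
  obtain ⟨u, hu, v, hv, huv⟩ : ∃ u ∈ X, ∃ v ∈ Y, u + v = e :=
    Submodule.mem_sup.1 (hXY.sup_eq_top ▸ Submodule.mem_top)
  have hmul {Z : Submodule A M} {z : M} (hz : z ∈ Z) (t : M) : p z t ∈ Z := by
    obtain ⟨a, ha⟩ := h.right_smul z t
    exact ha ▸ Z.smul_mem a hz
  have hsum (x : M) : p u x + p v x = x := by
    rw [← LinearMap.add_apply, ← map_add, huv, h.one_left]
  have hvX : v ∈ pairingAnnihilator p X := fun x hx =>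
    Submodule.disjoint_def.1 hXY.disjoint _
      (by rw [eq_sub_of_add_eq' (hsum x)]; exact X.sub_mem hx (hmul hu x)) (hmul hv x)
  have huY : u ∈ pairingAnnihilator p Y := fun x hx =>
    Submodule.disjoint_def.1 hXY.disjoint _ (hmul hu x)
      (by rw [eq_sub_of_add_eq (hsum x)]; exact Y.sub_mem hx (hmul hv x))
  refine ⟨pairingAnnihilator p Y, Submodule.disjoint_def.2 fun a haX haY => ?_,
    codisjoint_iff.2 (eq_top_iff.2 fun a _ => ?_)⟩
  · rw [← h.one_right a, ← huv, map_add, haX u hu, haY v hv, add_zero]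
  · obtain ⟨b, hb⟩ := h.left_smul a v
    obtain ⟨c, hc⟩ := h.left_smul a u
    rw [← h.one_right a, ← huv, map_add, add_comm, hb, hc]
    exact Submodule.add_mem_sup (Submodule.smul_mem _ b hvX) (Submodule.smul_mem _ c huY)

variable [SMulCommClass B A M]

theorem IsRingPairing.flip (h : IsRingPairing p e) : IsRingPairing p.flip e where
  assoc x y z := (h.assoc z y x).symm
  one_left := h.one_right
  one_right := h.one_left
  right_smul y t := h.left_smul t y
  left_smul t x := h.right_smul x t

theorem le_pairingAnnihilator_flip (p : M →ₗ[B] M →ₗ[A] M) (X : Submodule A M) :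
    X ≤ pairingAnnihilator p.flip (pairingAnnihilator p X) :=
  fun _ hx _ hy => hy _ hx

/-- If `y` lies in an essential extension of the annihilator of `S`, the `t` with `yt` in that
annihilator form an essential submodule. Each `sy` with `s ∈ S` kills it, so `sy = 0` by
nonsingularity. -/
theorem isClosedSubmodule_pairingAnnihilator (h : IsRingPairing p e)
    (hn : IsNonsingularPairing p) (S : Submodule B M) :
    IsClosedSubmodule (pairingAnnihilator p.flip S) := by
  intro Y hY
  refine le_antisymm hY.1 fun y hy s hs => ?_
  refine hn ((pairingAnnihilator p.flip S).comap (p y)) ⟨le_top, fun W _ hW => ?_⟩ _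
    fun t ht => ?_
  · have hmap : W.map (p y) ≤ Y := by
      rintro _ ⟨w, -, rfl⟩
      obtain ⟨a, ha⟩ := h.right_smul y w
      rw [ha]
      exact Y.smul_mem a hy
    have hzero : W.map (p y) = ⊥ := by
      refine hY.2 _ hmap (eq_bot_iff.2 ?_)
      rintro _ ⟨hz, w, hw, rfl⟩
      have : w ∈ (pairingAnnihilator p.flip S).comap (p y) ⊓ W := ⟨hz, hw⟩
      rw [hW, Submodule.mem_bot] at this
      simp [this]
    rw [← hW, eq_comm, inf_eq_right]
    intro w hw
    have : p y w ∈ W.map (p y) := ⟨w, hw, rfl⟩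
    rw [hzero, Submodule.mem_bot] at this
    rw [Submodule.mem_comap, this]
    exact Submodule.zero_mem _
  · change p (p s y) t = 0
    rw [h.assoc]
    exact ht s hs

theorem pairingAnnihilator_flip_pairingAnnihilator (hn : IsNonsingularPairing p)
    (hu : IsUtumiPairing p) {X : Submodule A M} (hX : IsClosedSubmodule X) :
    pairingAnnihilator p.flip (pairingAnnihilator p X) = X := by
  refine (hX _ ⟨le_pairingAnnihilator_flip p X, fun K hK hXK => ?_⟩).symm
  -- Whatever kills `J` kills `X`, hence also `K`, hence the essential `J ⊔ K`, and so is zero. By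
  -- the Utumi condition `J` is then essential, although it misses `K`.
  obtain ⟨J, hXJ, hJK, hess⟩ := exists_disjoint_sup_isEssentialIn (disjoint_iff.2 hXK)
  refine (hu J fun a ha => hn _ hess a fun y hy => ?_).2 K le_top (disjoint_iff.1 hJK)
  obtain ⟨j, hj, k, hk, rfl⟩ := Submodule.mem_sup.1 hy
  rw [map_add, ha j hj, zero_add]
  exact hK hk a fun x hx => ha x (hXJ hx)

theorem isMaximalClosed_pairingAnnihilator (h : IsRingPairing p e)
    (hn : IsNonsingularPairing p) (hu : IsUtumiPairing p)
    (hn' : IsNonsingularPairing p.flip) (hu' : IsUtumiPairing p.flip)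
    {X : Submodule A M} (hX : IsMinimalClosed X) :
    IsMaximalClosed (pairingAnnihilator p X) := by
  refine ⟨⟨isClosedSubmodule_pairingAnnihilator h.flip hn' X, fun htop => hX.1.2 ?_⟩,
    fun L hL hle => ?_⟩
  · rw [← pairingAnnihilator_flip_pairingAnnihilator hn hu hX.1.1, htop,
      h.flip.pairingAnnihilator_top]
  · have hLL : pairingAnnihilator p (pairingAnnihilator p.flip L) = L :=
      pairingAnnihilator_flip_pairingAnnihilator hn' hu' hL.1
    rw [← hLL]
    refine pairingAnnihilator_anti p (hX.2
      ⟨isClosedSubmodule_pairingAnnihilator h hn L, fun hbot => hL.2 ?_⟩ ?_)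
    · rw [← hLL, hbot, pairingAnnihilator_bot]
    · exact (pairingAnnihilator_anti p.flip hle).trans_eq
        (pairingAnnihilator_flip_pairingAnnihilator hn hu hX.1.1)

theorem isMinimalClosed_pairingAnnihilator (h : IsRingPairing p e)
    (hn : IsNonsingularPairing p) (hu : IsUtumiPairing p)
    (hn' : IsNonsingularPairing p.flip) (hu' : IsUtumiPairing p.flip)
    {X : Submodule A M} (hX : IsMaximalClosed X) :
    IsMinimalClosed (pairingAnnihilator p X) := by
  refine ⟨⟨isClosedSubmodule_pairingAnnihilator h.flip hn' X, fun hbot => hX.1.2 ?_⟩,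
    fun L hL hle => ?_⟩
  · rw [← pairingAnnihilator_flip_pairingAnnihilator hn hu hX.1.1, hbot, pairingAnnihilator_bot]
  · have hLL : pairingAnnihilator p (pairingAnnihilator p.flip L) = L :=
      pairingAnnihilator_flip_pairingAnnihilator hn' hu' hL.1
    rw [← hLL]
    refine pairingAnnihilator_anti p (hX.2
      ⟨isClosedSubmodule_pairingAnnihilator h hn L, fun htop => hL.2 ?_⟩ ?_)
    · rw [← hLL, htop, h.pairingAnnihilator_top]
    · exact (pairingAnnihilator_flip_pairingAnnihilator hn hu hX.1.1).symm.trans_le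
        (pairingAnnihilator_anti p.flip hle)

/-- Multiplication by a nonzero `x ∈ X` is the endomorphism; it sends `e` to `x`. Hence the
annihilation condition in max CS holds automatically for the maximal closed submodules arising here.
-/
theorem hasNonzeroEndAnnihilator_pairingAnnihilator (h : IsRingPairing p e)
    {X : Submodule A M} (hX : X ≠ ⊥) : HasNonzeroEndAnnihilator (pairingAnnihilator p X) := by
  obtain ⟨x, hx, hx0⟩ := Submodule.exists_mem_ne_zero_of_ne_bot hX
  refine ⟨p.flip x, fun h0 => hx0 ?_, fun y hy => hy x hx⟩
  rw [← h.one_left x]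
  exact LinearMap.congr_fun h0 e

theorem isMinCSModule_iff_isMaxCSModule (h : IsRingPairing p e)
    (hn : IsNonsingularPairing p) (hu : IsUtumiPairing p)
    (hn' : IsNonsingularPairing p.flip) (hu' : IsUtumiPairing p.flip) :
    IsMinCSModule A M ↔ IsMaxCSModule B M := by
  constructor
  · intro H L hL _
    rw [← pairingAnnihilator_flip_pairingAnnihilator hn' hu' hL.1.1]
    exact h.isComplemented_pairingAnnihilator
      (H _ (isMinimalClosed_pairingAnnihilator h.flip hn' hu' hn hu hL))
  · intro H X hX
    rw [← pairingAnnihilator_flip_pairingAnnihilator hn hu hX.1.1]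
    exact h.flip.isComplemented_pairingAnnihilator
      (H _ (isMaximalClosed_pairingAnnihilator h hn hu hn' hu' hX)
        (hasNonzeroEndAnnihilator_pairingAnnihilator h hX.1.2))

end Pairing

section Rings

variable (R : Type*) [Ring R]

/-- Multiplication of `R`, linear for left multiplication in the first argument and for right
multiplication in the second. -/
def mulPairing : R →ₗ[R] R →ₗ[Rᵐᵒᵖ] R :=
  LinearMap.mk₂' R Rᵐᵒᵖ (fun x y => x * y) add_mul (fun c x y => mul_assoc c x y) mul_add
    (fun c x y => (mul_assoc x y c.unop).symm)

theorem isRingPairing_mulPairing : IsRingPairing (mulPairing R) 1 where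
  assoc := mul_assoc
  one_left := one_mul
  one_right := mul_one
  right_smul _ t := ⟨MulOpposite.op t, rfl⟩
  left_smul t _ := ⟨t, rfl⟩

end Rings

end MaxMinCS

theorem theorem3p7 {R : Type*} [Ring R]
    (hns : MaxMinCS.IsNonsingular R) (hU : MaxMinCS.IsUtumi R) :
    (MaxMinCS.IsRightMinCS R ↔ MaxMinCS.IsLeftMaxCS R) ∧
    (MaxMinCS.IsRightMaxCS R ↔ MaxMinCS.IsLeftMinCS R) ∧
    (MaxMinCS.IsRightMaxMinCS R ↔ MaxMinCS.IsLeftMaxMinCS R) := by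
  have h := MaxMinCS.isRingPairing_mulPairing R
  have hmin : MaxMinCS.IsRightMinCS R ↔ MaxMinCS.IsLeftMaxCS R :=
    MaxMinCS.isMinCSModule_iff_isMaxCSModule h hns.1 hU.1 hns.2 hU.2
  have hmax : MaxMinCS.IsLeftMinCS R ↔ MaxMinCS.IsRightMaxCS R :=
    MaxMinCS.isMinCSModule_iff_isMaxCSModule h.flip hns.2 hU.2 hns.1 hU.1
  exact ⟨hmin, hmax.symm, (and_congr hmax.symm hmin).trans and_comm⟩
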